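/- Let $k$ be a field and let $R = k[x_1,\dots,x_d]$ be the polynomial ring with its standard grading. Let $I = (G)$ be the principal ideal generated by a nonzero form $G \in R$ of degree $\gamma$, and let $F = f_1,\dots,f_d$ be a regular sequence of forms of $R$, all of the same degree $\delta$. Assume that neither $\delta$ nor $\delta+\gamma$ is $0$ in $k$. Let $GF$ denote the sequence $Gf_1,\dots,Gf_d$, let $J = (Gf_1,\dots,Gf_d)$, and let $\mathrm{Jac}(GF) = \bigl(\partial (Gf_i)/\partial x_j\bigr)_{1\le i,j\le d}$ be its Jacobian matrix. Then the socle of $R/I^{d-1}J$, that is, the submodule of all elements annihilated by the maximal ideal $(x_1,\dots,x_d)$, is generated by the residue class of $\det \mathrm{Jac}(GF)$. -/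

import Mathlib

namespace JacobianSocle

/-- The homogeneous maximal ideal `(x₁, …, x_d)` of `k[x₁, …, x_d]`. -/
noncomputable def irrelevantIdeal (k : Type*) [Field k] (d : ℕ) : Ideal (MvPolynomial (Fin d) k) :=
  Ideal.span (Set.range (MvPolynomial.X : Fin d → MvPolynomial (Fin d) k))

/-- The socle of a module `M` over `k[x₁, …, x_d]`: the submodule of all elements of `M` that are
annihilated by the homogeneous maximal ideal `(x₁, …, x_d)`. -/
noncomputable def socle (k : Type*) [Field k] (d : ℕ) (M : Type*) [AddCommGroup M]
    [Module (MvPolynomial (Fin d) k) M] : Submodule (MvPolynomial (Fin d) k) M :=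
  Submodule.torsionBySet (MvPolynomial (Fin d) k) M
    (irrelevantIdeal k d : Set (MvPolynomial (Fin d) k))

/-- The Jacobian matrix of a sequence of `d` polynomials in `d` variables, with entry
`∂fᵢ/∂xⱼ` in row `i` and column `j`. -/
noncomputable def jac {k : Type*} [Field k] {d : ℕ} (f : Fin d → MvPolynomial (Fin d) k) :
    Matrix (Fin d) (Fin d) (MvPolynomial (Fin d) k) :=
  Matrix.of fun i j => MvPolynomial.pderiv j (f i)

end JacobianSocle

/-!
Let `f = A x` be a weakly regular sequence. Multiplication by `x` on the exterior algebra is a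
differential for which contraction with the `i`-th row of `A` is a homotopy from `0` to
multiplication by `fᵢ`. Passing to the quotient by one `fᵢ` at a time, these homotopies show that
the degree-zero cocycles modulo `(f)`, which form the ideal `(f) : (x)`, come from iterated
contractions of elements of top degree; such a contraction is a multiple of `det A`. Hence
`(f) : (x) = (f) + (det A)`.

By Euler's formula this applies to a regular sequence `F` of forms of degree `δ` and its Jacobian
matrix, up to the unit `δ`. For `d ≤ 1` the sequence `GF` is itself regular. For `d ≥ 2` we have
`I ^ (d - 1) * J = G ^ d * (F)`, the factor `G ^ d` comes out of the colon ideal because two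
variables are coprime, and `det Jac(GF) = δ⁻¹ (δ + γ) G ^ d det Jac(F)` by the rank-one update
formula.
-/

namespace JacobianSocle

open scoped Matrix
open MvPolynomial RingTheory.Sequence

section Koszul

variable {R M : Type*} [CommRing R] [AddCommGroup M] [Module R M]

local notation "Λ" => ExteriorAlgebra R M
local notation "ι" => ExteriorAlgebra.ι R

/-- The interior product (contraction) of the exterior algebra with a linear form. -/
noncomputable def interior : Module.Dual R M →ₗ[R] Module.End R (ExteriorAlgebra R M) :=
  CliffordAlgebra.contractLeft (Q := (0 : QuadraticForm R M))

theorem interior_ι_mul (φ : Module.Dual R M) (v : M) (b : Λ) :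
    interior φ (ι v * b) = φ v • b - ι v * interior φ b :=
  CliffordAlgebra.contractLeft_ι_mul φ v b

theorem interior_algebraMap (φ : Module.Dual R M) (r : R) : interior φ (algebraMap R Λ r) = 0 :=
  CliffordAlgebra.contractLeft_algebraMap _ φ r

theorem interior_mul_self (φ : Module.Dual R M) : interior φ * interior φ = 0 :=
  LinearMap.ext (CliffordAlgebra.contractLeft_contractLeft φ)

theorem interior_eq_zero_of_mem_zero (φ : Module.Dual R M) {b : Λ} (hb : b ∈ ⋀[R]^0 M) :
    interior φ b = 0 := by
  rw [ExteriorAlgebra.exteriorPower, pow_zero, Submodule.mem_one] at hb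
  obtain ⟨r, rfl⟩ := hb
  exact interior_algebraMap φ r

theorem ι_mul_mem {p : ℕ} (v : M) {b : Λ} (hb : b ∈ ⋀[R]^p M) : ι v * b ∈ ⋀[R]^(p + 1) M := by
  rw [ExteriorAlgebra.exteriorPower, pow_succ']
  exact Submodule.mul_mem_mul (LinearMap.mem_range_self _ v) hb

theorem interior_mem (φ : Module.Dual R M) {p : ℕ} {b : Λ} (hb : b ∈ ⋀[R]^(p + 1) M) :
    interior φ b ∈ ⋀[R]^p M := by
  induction p generalizing b with
  | zero =>
    rw [ExteriorAlgebra.exteriorPower, zero_add, pow_one] at hb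
    obtain ⟨v, rfl⟩ := hb
    rw [ExteriorAlgebra.exteriorPower, pow_zero, Submodule.mem_one]
    exact ⟨φ v, (CliffordAlgebra.contractLeft_ι _ φ v).symm⟩
  | succ p ih =>
    rw [ExteriorAlgebra.exteriorPower, pow_succ'] at hb
    induction hb using Submodule.mul_induction_on' with
    | mem_mul_mem x hx y hy =>
      obtain ⟨v, rfl⟩ := hx
      rw [interior_ι_mul]
      exact sub_mem (Submodule.smul_mem _ _ hy) (ι_mul_mem v (ih hy))
    | add x _ y _ hx hy => rw [map_add]; exact add_mem hx hy

theorem ι_mul_ι_mul (v : M) (b : Λ) : ι v * (ι v * b) = 0 := by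
  rw [← mul_assoc, ExteriorAlgebra.ι_sq_zero, zero_mul]

/-- The submodule `(φ₁ ξ, …, φₘ ξ) • Λ` of the exterior algebra `Λ` for a list `φ₁, …, φₘ` of
linear forms: the Koszul complex of `ξ` is studied modulo these submodules. -/
noncomputable def evalSubmodule (ξ : M) (l : List (Module.Dual R M)) :
    Submodule R (ExteriorAlgebra R M) :=
  Ideal.ofList (l.map (· ξ)) • ⊤

variable {ξ : M} {l l' : List (Module.Dual R M)} {φ : Module.Dual R M}

theorem map_mem_evalSubmodule (T : Module.End R Λ) {z : Λ} (hz : z ∈ evalSubmodule ξ l) :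
    T z ∈ evalSubmodule ξ l :=
  Submodule.smul_top_le_comap_smul_top _ T hz

theorem ι_mul_mem_evalSubmodule (v : M) {z : Λ} (hz : z ∈ evalSubmodule ξ l) :
    ι v * z ∈ evalSubmodule ξ l :=
  map_mem_evalSubmodule (LinearMap.mulLeft R (ι v)) hz

theorem mem_evalSubmodule_append_singleton {z : Λ} :
    z ∈ evalSubmodule ξ (l ++ [φ]) ↔ ∃ t, z - φ ξ • t ∈ evalSubmodule ξ l := by
  simp only [evalSubmodule, List.map_append, List.map_singleton, Ideal.ofList_append,
    Ideal.ofList_singleton, Submodule.sup_smul, Submodule.ideal_span_singleton_smul,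
    Submodule.mem_sup, Submodule.mem_smul_pointwise_iff_exists]
  constructor
  · rintro ⟨y, hy, _, ⟨t, -, rfl⟩, rfl⟩
    exact ⟨t, by rwa [add_sub_cancel_right]⟩
  · rintro ⟨t, ht⟩
    exact ⟨_, ht, _, ⟨t, trivial, rfl⟩, sub_add_cancel _ _⟩

theorem mem_evalSubmodule_of_smul_mem (hreg : IsWeaklyRegular Λ ((l ++ φ :: l').map (· ξ))) {z : Λ}
    (hz : φ ξ • z ∈ evalSubmodule ξ l) : z ∈ evalSubmodule ξ l := by
  rw [List.map_append, List.map_cons, isWeaklyRegular_append_iff, isWeaklyRegular_cons_iff] at hreg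
  exact mem_of_isSMulRegular_quotient_of_smul_mem hreg.2.1 hz

theorem ι_mul_interior_mem {b b' : Λ} (hb : ι ξ * b - φ ξ • b' ∈ evalSubmodule ξ l) :
    ι ξ * interior φ b ∈ evalSubmodule ξ (l ++ [φ]) := by
  refine mem_evalSubmodule_append_singleton.2 ⟨b - interior φ b', ?_⟩
  convert neg_mem (map_mem_evalSubmodule (interior φ) hb) using 1
  rw [map_sub, map_smul, interior_ι_mul]
  module

/-- The homotopy formula `φ ⌋ (ξ ∧ b) + ξ ∧ (φ ⌋ b) = φ ξ • b` with `φ ξ` cancelled: `b'` is the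
image of the cocycle `b` under the connecting homomorphism for multiplication by `φ ξ`. -/
theorem sub_interior_sub_ι_mul_mem (hreg : IsWeaklyRegular Λ ((l ++ φ :: l').map (· ξ)))
    {b b' s t : Λ} (hb : ι ξ * b - φ ξ • b' ∈ evalSubmodule ξ l)
    (hφb : interior φ b - ι ξ * s - φ ξ • t ∈ evalSubmodule ξ l) :
    b - interior φ b' - ι ξ * t ∈ evalSubmodule ξ l := by
  refine mem_evalSubmodule_of_smul_mem hreg ?_
  have h := add_mem (map_mem_evalSubmodule (interior φ) hb) (ι_mul_mem_evalSubmodule ξ hφb)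
  simp only [map_sub, map_smul, interior_ι_mul, mul_sub, mul_smul_comm, ι_mul_ι_mul] at h
  convert h using 1
  module

theorem exists_sub_interior_sub_ι_mul_mem (hreg : IsWeaklyRegular Λ ((l ++ φ :: l').map (· ξ)))
    {p : ℕ} (hp : p ≤ l'.length) {b b' : Λ} (hb : b ∈ ⋀[R]^p M)
    (hξb : ι ξ * b - φ ξ • b' ∈ evalSubmodule ξ l) :
    ∃ t, b - interior φ b' - ι ξ * t ∈ evalSubmodule ξ l := by
  induction p generalizing l φ l' b b' with
  | zero =>
    refine ⟨0, sub_interior_sub_ι_mul_mem (s := 0) hreg hξb ?_⟩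
    simp [interior_eq_zero_of_mem_zero φ hb]
  | succ p ih =>
    obtain ⟨ψ, l', rfl⟩ := List.exists_cons_of_length_pos (Nat.zero_lt_of_lt hp)
    have hcocycle : ι ξ * interior φ b - ψ ξ • (0 : Λ) ∈ evalSubmodule ξ (l ++ [φ]) := by
      rw [smul_zero, sub_zero]
      exact ι_mul_interior_mem hξb
    obtain ⟨s, hs⟩ := ih (by simpa using hreg) (Nat.le_of_succ_le_succ hp) (interior_mem φ hb)
      hcocycle
    rw [map_zero, sub_zero, mem_evalSubmodule_append_singleton] at hs
    obtain ⟨t, ht⟩ := hs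
    exact ⟨t, sub_interior_sub_ι_mul_mem hreg hξb ht⟩

theorem exists_mem_exteriorPower_ι_mul_sub_smul_mem {p : ℕ} {b : Λ} (hb : b ∈ ⋀[R]^p M)
    (hξb : ι ξ * b ∈ evalSubmodule ξ (l ++ [φ])) :
    ∃ b' ∈ ⋀[R]^(p + 1) M, ι ξ * b - φ ξ • b' ∈ evalSubmodule ξ l := by
  obtain ⟨c, hc⟩ := mem_evalSubmodule_append_singleton.1 hξb
  let π : Module.End R Λ := GradedAlgebra.proj (fun i : ℕ => ⋀[R]^i M) (p + 1)
  have hπ : π (ι ξ * b) = ι ξ * b :=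
    DirectSum.decompose_of_mem_same (fun i : ℕ => ⋀[R]^i M) (ι_mul_mem ξ hb)
  refine ⟨π c, SetLike.coe_mem (DirectSum.decompose (fun i : ℕ => ⋀[R]^i M) c (p + 1)), ?_⟩
  simpa only [map_sub, map_smul, hπ] using map_mem_evalSubmodule π hc

theorem ι_mul_mem_evalSubmodule_of_sub_smul_mem
    (hreg : IsWeaklyRegular Λ ((l ++ φ :: l').map (· ξ))) {b b' : Λ}
    (hb : ι ξ * b - φ ξ • b' ∈ evalSubmodule ξ l) : ι ξ * b' ∈ evalSubmodule ξ l := by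
  refine mem_evalSubmodule_of_smul_mem hreg ?_
  have h := ι_mul_mem_evalSubmodule ξ hb
  rwa [mul_sub, ι_mul_ι_mul, zero_sub, neg_mem_iff, mul_smul_comm] at h

theorem exists_sub_prod_interior_sub_ι_mul_mem
    (hreg : IsWeaklyRegular Λ ((l ++ l').map (· ξ))) {b : Λ} (hb : b ∈ ⋀[R]^l'.length M)
    (hξb : ι ξ * b ∈ evalSubmodule ξ l) :
    ∃ c w, b - (l.map interior).reverse.prod c - ι ξ * w ∈ evalSubmodule ξ l := by
  induction l using List.reverseRecOn generalizing l' b with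
  | nil => exact ⟨b, 0, by simp⟩
  | append_singleton l φ ih =>
    rw [List.append_assoc, List.singleton_append] at hreg
    obtain ⟨b', hb', hbb'⟩ := exists_mem_exteriorPower_ι_mul_sub_smul_mem hb hξb
    obtain ⟨c, w, hcw⟩ := ih hreg hb' (ι_mul_mem_evalSubmodule_of_sub_smul_mem hreg hbb')
    obtain ⟨t, ht⟩ := exists_sub_interior_sub_ι_mul_mem hreg le_rfl hb hbb'
    refine ⟨c, t - interior φ w, mem_evalSubmodule_append_singleton.2 ⟨w, ?_⟩⟩
    convert add_mem ht (map_mem_evalSubmodule (interior φ) hcw) using 1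
    simp only [List.map_append, List.map_singleton, List.reverse_append, List.reverse_singleton,
      List.singleton_append, List.prod_cons, Module.End.mul_apply, map_sub, interior_ι_mul, mul_sub]
    abel

end Koszul

section Colon

variable {R : Type*} [CommRing R]

/-- The composite `φ ↦ interior φₙ ∘ ⋯ ∘ interior φ₁`, which is alternating because each
`interior φ` squares to zero. -/
noncomputable def iteratedInterior (R M : Type*) [CommRing R] [AddCommGroup M] [Module R M]
    (n : ℕ) : Module.Dual R M [⋀^Fin n]→ₗ[R] Module.End R (ExteriorAlgebra R M) :=
  ((ExteriorAlgebra.lift R ⟨interior, interior_mul_self⟩).toLinearMap ∘ₗ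
    CliffordAlgebra.reverse).compAlternatingMap (ExteriorAlgebra.ιMulti R n)

theorem iteratedInterior_apply {M : Type*} [AddCommGroup M] [Module R M] {n : ℕ}
    (φ : Fin n → Module.Dual R M) :
    iteratedInterior R M n φ = ((List.ofFn φ).map interior).reverse.prod := by
  let ρ : ExteriorAlgebra R (Module.Dual R M) →ₐ[R] Module.End R (ExteriorAlgebra R M) :=
    ExteriorAlgebra.lift R ⟨interior, interior_mul_self⟩
  have hreverse : CliffordAlgebra.reverse (ExteriorAlgebra.ιMulti R n φ) =
      ((List.ofFn φ).map (ExteriorAlgebra.ι R)).reverse.prod := by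
    rw [← CliffordAlgebra.reverse_prod_map_ι, ExteriorAlgebra.ιMulti_apply, List.map_ofFn]
    rfl
  have hρ : ρ ∘ ExteriorAlgebra.ι R = interior :=
    funext (ExteriorAlgebra.lift_ι_apply R _ interior_mul_self)
  change ρ (CliffordAlgebra.reverse (ExteriorAlgebra.ιMulti R n φ)) = _
  rw [hreverse, map_list_prod, List.map_reverse, List.map_map, hρ]

theorem det_dvd_alternatingMap_apply {n : Type*} [Fintype n] [DecidableEq n]
    (Φ : (n → R) [⋀^n]→ₗ[R] R) (A : Matrix n n R) : A.det ∣ Φ fun i => A i := by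
  rw [Φ.eq_smul_basis_det (Pi.basisFun R n), AlternatingMap.smul_apply, Pi.basisFun_det]
  exact dvd_mul_left _ _

theorem det_dvd_algebraMapInv_prod_interior {n : ℕ} (A : Matrix (Fin n) (Fin n) R)
    (c : ExteriorAlgebra R (Fin n → R)) :
    A.det ∣ ExteriorAlgebra.algebraMapInv
      (((List.ofFn fun i => dotProductBilin R R (A i)).map interior).reverse.prod c) := by
  rw [← iteratedInterior_apply]
  exact det_dvd_alternatingMap_apply
    (((ExteriorAlgebra.algebraMapInv.toLinearMap ∘ₗ LinearMap.applyₗ c).compAlternatingMap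
      (iteratedInterior R (Fin n → R) n)).compLinearMap (dotProductBilin R R)) A

theorem isWeaklyRegular_of_flat {N : Type*} [AddCommGroup N] [Module R N] [Module.Flat R N]
    {rs : List R} (h : IsWeaklyRegular R rs) : IsWeaklyRegular N rs :=
  ((TensorProduct.lid R N).isWeaklyRegular_congr rs).1 h.isWeaklyRegular_rTensor

theorem exteriorAlgebra_pi_free (n : Type*) [Finite n] [LinearOrder n] :
    Module.Free R (ExteriorAlgebra R (n → R)) :=
  .of_basis (Pi.basisFun R n).ExteriorAlgebra

theorem smul_mem_ideal_smul_top {n : Type*} [Finite n] {I : Ideal R} {x : n → R}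
    (hx : ∀ j, x j ∈ I) : x ∈ I • (⊤ : Submodule R (n → R)) := by
  have := Fintype.ofFinite n
  classical
  rw [pi_eq_sum_univ' x]
  exact sum_mem fun j _ => Submodule.smul_mem_smul (hx j) trivial

theorem ofList_ofFn {n : ℕ} (f : Fin n → R) :
    Ideal.ofList (List.ofFn f) = Ideal.span (Set.range f) := by
  simp only [Ideal.ofList, List.mem_ofFn]
  rfl

theorem mem_sup_span_det {n : ℕ} (A : Matrix (Fin n) (Fin n) R) (x : Fin n → R)
    (hreg : IsWeaklyRegular R (List.ofFn (A *ᵥ x))) {a : R}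
    (ha : ∀ j, a * x j ∈ Ideal.span (Set.range (A *ᵥ x))) :
    a ∈ Ideal.span (Set.range (A *ᵥ x)) ⊔ Ideal.span {A.det} := by
  have := exteriorAlgebra_pi_free (R := R) (Fin n)
  let rows : List (Module.Dual R (Fin n → R)) := List.ofFn fun i => dotProductBilin R R (A i)
  have hrows : rows.map (· x) = List.ofFn (A *ᵥ x) := List.map_ofFn
  have hmap : ∀ z ∈ evalSubmodule x rows,
      ExteriorAlgebra.algebraMapInv z ∈ Ideal.span (Set.range (A *ᵥ x)) := fun z hz => by
    rw [evalSubmodule, hrows, ofList_ofFn] at hz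
    simpa using Submodule.smul_top_le_comap_smul_top _
      ExteriorAlgebra.algebraMapInv.toLinearMap hz
  have hcocycle : ExteriorAlgebra.ι R x * algebraMap R _ a ∈ evalSubmodule x rows := by
    rw [← Algebra.commutes, ← Algebra.smul_def, ← map_smul, evalSubmodule, hrows, ofList_ofFn]
    exact Submodule.smul_top_le_comap_smul_top _ (ExteriorAlgebra.ι R) (smul_mem_ideal_smul_top ha)
  obtain ⟨c, w, hcw⟩ := exists_sub_prod_interior_sub_ι_mul_mem (l' := [])
    (by simpa [hrows] using isWeaklyRegular_of_flat hreg)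
    (by rw [ExteriorAlgebra.exteriorPower, List.length_nil, pow_zero]
        exact Submodule.algebraMap_mem a) hcocycle
  have hι : ExteriorAlgebra.algebraMapInv (ExteriorAlgebra.ι R x) = 0 :=
    ExteriorAlgebra.lift_ι_apply R _ _ _
  have hdet := hmap _ hcw
  rw [map_sub, map_sub, ExteriorAlgebra.algebraMap_leftInverse, map_mul, hι, zero_mul,
    sub_zero] at hdet
  exact Submodule.mem_sup.2 ⟨_, hdet, _, Ideal.mem_span_singleton.2
    (det_dvd_algebraMapInv_prod_interior A c), sub_add_cancel _ _⟩

theorem det_mul_mem_span_range_mulVec {n : Type*} [Fintype n] [DecidableEq n] (A : Matrix n n R)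
    (x : n → R) (j : n) : A.det * x j ∈ Ideal.span (Set.range (A *ᵥ x)) := by
  have hcramer : A.det * x j = (A.adjugate *ᵥ (A *ᵥ x)) j := by
    rw [Matrix.mulVec_mulVec, Matrix.adjugate_mul, Matrix.smul_mulVec, Matrix.one_mulVec,
      Pi.smul_apply, smul_eq_mul]
  rw [hcramer]
  exact sum_mem fun i _ => Ideal.mul_mem_left _ _ (Ideal.subset_span (Set.mem_range_self i))

/-- Wiebe's formula. -/
theorem colon_range_eq_sup_span_det {n : ℕ} (A : Matrix (Fin n) (Fin n) R) (x : Fin n → R)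
    (hreg : IsWeaklyRegular R (List.ofFn (A *ᵥ x))) :
    (Ideal.span (Set.range (A *ᵥ x))).colon (Set.range x) =
      Ideal.span (Set.range (A *ᵥ x)) ⊔ Ideal.span {A.det} := by
  refine le_antisymm (fun a ha => ?_) (sup_le Ideal.le_colon ?_)
  · exact mem_sup_span_det A x hreg fun j => Submodule.mem_colon.1 ha _ (Set.mem_range_self j)
  · rw [Ideal.span_singleton_le_iff_mem, Submodule.mem_colon, Set.forall_mem_range]
    exact det_mul_mem_span_range_mulVec A x

theorem span_range_mul_left {ι : Type*} (g : R) (f : ι → R) :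
    Ideal.span (Set.range fun i => g * f i) = Ideal.span {g} * Ideal.span (Set.range f) := by
  rw [Ideal.span_mul_span', Set.singleton_mul, ← Set.range_comp]
  rfl

theorem colon_span_singleton_mul {H : R} (hH : H ∈ nonZeroDivisors R) {S : Set R}
    (hS : (Ideal.span {H}).colon S = Ideal.span {H}) (Q : Ideal R) :
    (Ideal.span {H} * Q).colon S = Ideal.span {H} * Q.colon S := by
  have hcancel : ∀ {P : Ideal R} {b : R}, H * b ∈ Ideal.span {H} * P ↔ b ∈ P := by
    simp [Ideal.mem_span_singleton_mul, mul_cancel_left_mem_nonZeroDivisors hH]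
  have hle : ∀ P, Ideal.span {H} * P ≤ Ideal.span {H} := fun _ => Ideal.mul_le_left
  have hmul : ∀ b, H * b ∈ (Ideal.span {H} * Q).colon S ↔ b ∈ Q.colon S := fun b => by
    simp only [Submodule.mem_colon, smul_eq_mul, mul_assoc, hcancel]
  ext a
  by_cases ha : a ∈ Ideal.span {H}
  · obtain ⟨b, rfl⟩ := Ideal.mem_span_singleton.1 ha
    rw [hmul, hcancel]
  · exact iff_of_false (fun h => ha (hS.le (Submodule.colon_mono (hle Q) subset_rfl h)))
      fun h => ha (hle _ h)

theorem dvd_of_dvd_prime_mul_of_dvd_mul {R : Type*} [CommMonoidWithZero R] [IsCancelMulZero R]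
    {p q H a : R} (hp : Prime p) (hq : ¬p ∣ q) (hpa : H ∣ p * a) (hqa : H ∣ q * a) : H ∣ a := by
  rcases eq_or_ne H 0 with rfl | hH
  · simpa [hp.ne_zero] using hpa
  obtain ⟨b, hb⟩ := hpa
  obtain ⟨c, hc⟩ := hqa
  have hqb : q * b = p * c := mul_left_cancel₀ hH <| by
    rw [mul_left_comm, ← hb, mul_left_comm q p a, hc, mul_left_comm]
  obtain ⟨b', rfl⟩ := (hp.dvd_or_dvd (Dvd.intro _ hqb.symm)).resolve_left hq
  exact ⟨b', mul_left_cancel₀ hp.ne_zero (hb.trans (mul_left_comm _ _ _))⟩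

theorem det_scalar_add_vecMulVec {n : Type*} [Fintype n] [DecidableEq n] [Nonempty n]
    (g : R) (u v : n → R) :
    (Matrix.scalar n g + Matrix.vecMulVec u v).det = g ^ (Fintype.card n - 1) * (g + u ⬝ᵥ v) := by
  have heval := Matrix.eval_charpoly (Matrix.vecMulVec (-u) v) g
  rw [Matrix.charpoly_vecMulVec, Matrix.neg_vecMulVec, sub_neg_eq_add] at heval
  rw [← heval, ← pow_sub_one_mul (Fintype.card_ne_zero (α := n))]
  simp only [Polynomial.eval_sub, Polynomial.eval_mul, Polynomial.eval_pow, Polynomial.eval_X,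
    Polynomial.eval_smul, neg_dotProduct, smul_eq_mul]
  ring

theorem isWeaklyRegular_ofFn_mul_of_le_one {n : ℕ} (hn : n ≤ 1) {g : R} (hg : IsSMulRegular R g)
    {f : Fin n → R} (hf : IsWeaklyRegular R (List.ofFn f)) :
    IsWeaklyRegular R (List.ofFn fun i => g * f i) := by
  interval_cases n
  · simp
  · simp only [List.ofFn_succ, List.ofFn_zero, isWeaklyRegular_singleton_iff] at hf ⊢
    exact hg.mul hf

end Colon

section Jacobian

theorem colon_span_singleton_range_X {k σ : Type*} [CommRing k] [IsDomain k] [Nontrivial σ]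
    (H : MvPolynomial σ k) :
    (Ideal.span {H}).colon (Set.range X) = Ideal.span {H} := by
  obtain ⟨i, j, hij⟩ := exists_pair_ne σ
  refine le_antisymm (fun a ha => ?_) Ideal.le_colon
  simp only [Submodule.mem_colon, Set.forall_mem_range, smul_eq_mul, mul_comm a,
    Ideal.mem_span_singleton] at ha ⊢
  exact dvd_of_dvd_prime_mul_of_dvd_mul (X_prime (i := i)) (by simpa [X_dvd_X]) (ha i) (ha j)

variable {k : Type*} [Field k] {d γ δ : ℕ} {G : MvPolynomial (Fin d) k}
  {F : Fin d → MvPolynomial (Fin d) k}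

theorem socle_quotient (Q : Ideal (MvPolynomial (Fin d) k)) :
    socle k d (MvPolynomial (Fin d) k ⧸ Q) = Submodule.map Q.mkQ (Q.colon (Set.range X)) := by
  have hmem : ∀ a, Q.mkQ a ∈ socle k d (MvPolynomial (Fin d) k ⧸ Q) ↔ a ∈ Q.colon (Set.range X) :=
    fun a => by
      rw [socle, irrelevantIdeal, ← Submodule.torsionBySet_eq_torsionBySet_span]
      simp only [Submodule.mem_torsionBySet_iff, Subtype.forall, Set.forall_mem_range,
        Submodule.mem_colon, smul_eq_mul, mul_comm a]
      exact forall_congr' fun i => Submodule.Quotient.mk_eq_zero Q (x := X i * a)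
  rw [← Submodule.map_comap_eq_of_surjective Q.mkQ_surjective (socle k d _)]
  exact congrArg _ (Submodule.ext hmem)

theorem socle_quotient_eq_span_mk {Q : Ideal (MvPolynomial (Fin d) k)}
    {D : MvPolynomial (Fin d) k} (h : Q.colon (Set.range X) = Q ⊔ Ideal.span {D}) :
    socle k d (MvPolynomial (Fin d) k ⧸ Q) =
      Submodule.span (MvPolynomial (Fin d) k) {Ideal.Quotient.mk Q D} := by
  rw [socle_quotient, h, Submodule.map_sup, Submodule.mkQ_map_self, bot_sup_eq, Ideal.span,
    Submodule.map_span, Set.image_singleton]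
  rfl

theorem smul_jac_mulVec_X (hF : ∀ i, (F i).IsHomogeneous δ) (hδ : (δ : k) ≠ 0) :
    (C (σ := Fin d) (δ : k)⁻¹ • jac F) *ᵥ X = F := by
  funext i
  have hunit : (C (δ : k)⁻¹ : MvPolynomial (Fin d) k) * δ = 1 := by
    rw [← map_natCast C, ← map_mul, inv_mul_cancel₀ hδ, map_one]
  have heuler : (jac F *ᵥ X) i = δ * F i := by
    rw [← nsmul_eq_mul, ← (hF i).sum_X_mul_pderiv]
    simp only [Matrix.mulVec, dotProduct, jac, Matrix.of_apply, mul_comm]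
  rw [Matrix.smul_mulVec, Pi.smul_apply, heuler, smul_eq_mul, ← mul_assoc, hunit, one_mul]

theorem colon_range_X_eq_sup_span_det_jac (hF : ∀ i, (F i).IsHomogeneous δ) (hδ : (δ : k) ≠ 0)
    (hreg : IsWeaklyRegular (MvPolynomial (Fin d) k) (List.ofFn F)) :
    (Ideal.span (Set.range F)).colon (Set.range X) =
      Ideal.span (Set.range F) ⊔ Ideal.span {(jac F).det} := by
  have hA := smul_jac_mulVec_X hF hδ
  have hunit : IsUnit (C (σ := Fin d) (δ : k)⁻¹ ^ Fintype.card (Fin d)) :=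
    ((IsUnit.mk0 _ (inv_ne_zero hδ)).map C).pow _
  have hcolon := colon_range_eq_sup_span_det (C (σ := Fin d) (δ : k)⁻¹ • jac F) X (by rwa [hA])
  rwa [hA, Matrix.det_smul, Ideal.span_singleton_mul_left_unit hunit] at hcolon

theorem jac_mul (hF : ∀ i, (F i).IsHomogeneous δ) (hδ : (δ : k) ≠ 0) :
    jac (fun i => G * F i) = jac F * (Matrix.scalar (Fin d) G +
      Matrix.vecMulVec (C (σ := Fin d) (δ : k)⁻¹ • X) fun j => pderiv j G) := by
  have hA := smul_jac_mulVec_X hF hδ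
  rw [Matrix.smul_mulVec, ← Matrix.mulVec_smul] at hA
  rw [mul_add, Matrix.mul_vecMulVec, hA]
  ext1 i j
  simp [jac, Matrix.vecMulVec_apply, Derivation.leibniz, mul_comm]

theorem det_jac_mul [NeZero d] (hG : G.IsHomogeneous γ) (hF : ∀ i, (F i).IsHomogeneous δ)
    (hδ : (δ : k) ≠ 0) :
    (jac fun i => G * F i).det =
      C ((δ : k)⁻¹ * (δ + γ : ℕ)) * (G ^ d * (jac F).det) := by
  have heuler : (X : Fin d → MvPolynomial (Fin d) k) ⬝ᵥ (fun j => pderiv j G) = C (γ : k) * G := by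
    rw [map_natCast, ← nsmul_eq_mul]
    exact hG.sum_X_mul_pderiv
  have hunit : (C (δ : k)⁻¹ * C (δ : k) : MvPolynomial (Fin d) k) = 1 := by
    rw [← map_mul, inv_mul_cancel₀ hδ, map_one]
  rw [jac_mul hF hδ, Matrix.det_mul, det_scalar_add_vecMulVec, smul_dotProduct, heuler,
    Fintype.card_fin, ← pow_sub_one_mul (NeZero.ne d), Nat.cast_add, map_mul, map_add, smul_eq_mul]
  linear_combination -((jac F).det * G ^ (d - 1) * G) * hunit

theorem colon_range_X_of_two_le (hd : 2 ≤ d) (hG : G.IsHomogeneous γ) (hG0 : G ≠ 0)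
    (hF : ∀ i, (F i).IsHomogeneous δ)
    (hreg : IsWeaklyRegular (MvPolynomial (Fin d) k) (List.ofFn F))
    (hδ : (δ : k) ≠ 0) (hδγ : ((δ + γ : ℕ) : k) ≠ 0) :
    (Ideal.span {G ^ d} * Ideal.span (Set.range F)).colon (Set.range X) =
      Ideal.span {G ^ d} * Ideal.span (Set.range F) ⊔
        Ideal.span {(jac fun i => G * F i).det} := by
  have : NeZero d := ⟨by lia⟩
  have : Nontrivial (Fin d) := Fin.nontrivial_iff_two_le.2 hd
  have hunit : IsUnit (C (σ := Fin d) ((δ : k)⁻¹ * (δ + γ : ℕ))) :=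
    (IsUnit.mk0 _ (mul_ne_zero (inv_ne_zero hδ) hδγ)).map C
  rw [colon_span_singleton_mul (mem_nonZeroDivisors_of_ne_zero (pow_ne_zero d hG0))
      (colon_span_singleton_range_X _), colon_range_X_eq_sup_span_det_jac hF hδ hreg, Ideal.mul_sup,
    Ideal.span_singleton_mul_span_singleton, det_jac_mul hG hF hδ,
    Ideal.span_singleton_mul_left_unit hunit]

end Jacobian

end JacobianSocle

theorem proposition6p5 {k : Type*} [Field k] (d γ δ : ℕ)
    (G : MvPolynomial (Fin d) k) (hG : G.IsHomogeneous γ) (hG0 : G ≠ 0)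
    (F : Fin d → MvPolynomial (Fin d) k) (hF : ∀ i, (F i).IsHomogeneous δ)
    (hreg : RingTheory.Sequence.IsRegular (MvPolynomial (Fin d) k) (List.ofFn F))
    (hδ : (δ : k) ≠ 0) (hδγ : ((δ + γ : ℕ) : k) ≠ 0)
    (I J : Ideal (MvPolynomial (Fin d) k))
    (hI : I = Ideal.span {G})
    (hJ : J = Ideal.span (Set.range fun i => G * F i)) :
    JacobianSocle.socle k d (MvPolynomial (Fin d) k ⧸ (I ^ (d - 1) * J)) =
      Submodule.span (MvPolynomial (Fin d) k)
        {Ideal.Quotient.mk (I ^ (d - 1) * J)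
          (JacobianSocle.jac fun i => G * F i).det} := by
  refine JacobianSocle.socle_quotient_eq_span_mk ?_
  have hFreg := hreg.toIsWeaklyRegular
  rcases Nat.lt_or_ge 1 d with hd | hd
  · have hQ : I ^ (d - 1) * J = Ideal.span {G ^ d} * Ideal.span (Set.range F) := by
      rw [hI, hJ, JacobianSocle.span_range_mul_left, ← mul_assoc, pow_sub_one_mul (by lia),
        Ideal.span_singleton_pow]
    rw [hQ]
    exact JacobianSocle.colon_range_X_of_two_le hd hG hG0 hF hFreg hδ hδγ
  · have hGF : ∀ i, (G * F i).IsHomogeneous (δ + γ) := fun i => add_comm γ δ ▸ hG.mul (hF i)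
    rw [Nat.sub_eq_zero_of_le hd, pow_zero, one_mul, hJ]
    exact JacobianSocle.colon_range_X_eq_sup_span_det_jac hGF hδγ
      (JacobianSocle.isWeaklyRegular_ofFn_mul_of_le_one hd (.of_ne_zero hG0) hFreg)
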